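/- Let $(\mathcal A,G,\alpha)$ be a free C$^*$-dynamical system, i.e. $\mathcal A$ is a unital C$^*$-algebra, $G$ a compact (Hausdorff) group, $\alpha:G\to\mathrm{Aut}(\mathcal A)$ a strongly continuous homomorphism into the group of $*$-automorphisms, and the span of the functions $g\mapsto x\,\alpha_g(y)$ ($x,y\in\mathcal A$) is dense in $C(G,\mathcal A)$. Let $1\to Z\to\hat G\xrightarrow{q}G\to1$ be a central extension of compact (Hausdorff) groups, with $Z$ regarded as a subgroup of $\hat G$, and let $(\hat{\mathcal A},Z,\theta)$ be a free C$^*$-dynamical system, $\hat{\mathcal A}$ unital, with fixed point algebra $\hat{\mathcal A}^Z=\mathcal A$. Put $$\mathrm{Aut}_Z(\hat{\mathcal A})=\{\hat\varphi\in\mathrm{Aut}(\hat{\mathcal A}):\theta_z\circ\hat\varphi=\hat\varphi\circ\theta_z\ \forall z\in Z\},\qquad \mathrm{Gau}_Z(\hat{\mathcal A})=\{\hat\varphi\in\mathrm{Aut}_Z(\hat{\mathcal A}):\hat\varphi|_{\mathcal A}=\mathrm{id}_{\mathcal A}\},$$ and let $\mathrm{Aut}(\mathcal A)_{[\hat{\mathcal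 A}]}$ be the group of those $*$-automorphisms of $\mathcal A$ that extend to an element of $\mathrm{Aut}_Z(\hat{\mathcal A})$. The group $\mathrm{Gau}_Z(\hat{\mathcal A})$ is abelian. Theorem. Suppose that $\alpha(G)\subseteq\mathrm{Aut}(\mathcal A)_{[\hat{\mathcal A}]}$, and let $\hat\alpha:\hat G\to\mathrm{Aut}(\hat{\mathcal A})$, $\hat g\mapsto\hat\alpha_{\hat g}$, be a map (not assumed to be a homomorphism) such that 1. $\hat\alpha_{e}=\mathrm{id}_{\hat{\mathcal A}}$ and $\hat\alpha(\hat G)\subseteq\mathrm{Aut}_Z(\hat{\mathcal A})$; 2. $\hat\alpha_{\hat g}|_{\mathcal A}=\alpha_{q(\hat g)}$ for all $\hat g\in\hat G$; 3. $\hat\alpha_z=\theta_z$ for all $z\in Z$; 4. $\hat\alpha_{z\hat g}=\hat\alpha_z\circ\hat\alpha_{\hat g}$ for all $z\in Z$, $\hat g\in\hat G$. Let $S:G\to\mathrm{Aut}(\mathrm{Gau}_Z(\hat{\mathcal A}))$ be the (well-defined) homomorphism $S(g)(\hat\varphi)=\hat\alpha_{\hat g}\circ\hat\varphi\circ\hat\alpha_{\hat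 g}^{-1}$, and let $\delta_{\hat\alpha,G}\in Z^2_S(G,\mathrm{Gau}_Z(\hat{\mathcal A}))$ be the (well-defined) $2$-cocycle $\delta_{\hat\alpha,G}(g,g')=\hat\alpha_{\hat g}\circ\hat\alpha_{\hat g'}\circ\hat\alpha_{\hat g\hat g'}^{-1}$, where $\hat g,\hat g'\in\hat G$ are any elements with $q(\hat g)=g$, $q(\hat g')=g'$. If the class $[\delta_{\hat\alpha,G}]$ in the (abstract) group cohomology $H^2_S(G,\mathrm{Gau}_Z(\hat{\mathcal A}))$ is trivial, then $\alpha$ lifts to a $\hat G$-action on $\hat{\mathcal A}$ whose restriction to $Z$ is $\theta$: there is a group homomorphism $\beta:\hat G\to\mathrm{Aut}(\hat{\mathcal A})$ (no continuity is claimed) with $\beta_{\hat g}|_{\mathcal A}=\alpha_{q(\hat g)}$ for all $\hat g\in\hat G$ and $\beta_z=\theta_z$ for all $z\in Z$. -/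

import Mathlib

open MeasureTheory
open scoped TensorProduct

noncomputable section

/-! ## C*-dynamical systems -/

/-- A (unital) C*-dynamical system `(A, G, α)`: a strongly continuous homomorphism from the
topological group `G` into the group of *-automorphisms of the unital C*-algebra `A`. -/
structure CStarDynamicalSystem (G A : Type*) [Group G] [TopologicalSpace G] [CStarAlgebra A] where
  /-- the action `α : G → Aut(A)` -/
  act : G →* (A ≃⋆ₐ[ℂ] A)
  /-- strong continuity -/
  continuous_act : ∀ a : A, Continuous fun g : G => act g a

namespace CStarDynamicalSystem

section Basic

variable {G A : Type*} [Group G] [TopologicalSpace G] [CStarAlgebra A]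

/-- The fixed point algebra of a C*-dynamical system. -/
def fixedPointAlgebra (α : CStarDynamicalSystem G A) : StarSubalgebra ℂ A where
  carrier := {a | ∀ g, α.act g a = a}
  mul_mem' := fun ha hb g => by rw [map_mul, ha g, hb g]
  one_mem' := fun g => map_one _
  add_mem' := fun ha hb g => by rw [map_add, ha g, hb g]
  zero_mem' := fun g => map_zero _
  algebraMap_mem' := fun r g => by
    rw [Algebra.algebraMap_eq_smul_one, map_smul, map_one]
  star_mem' := fun ha g => by rw [map_star, ha g]

theorem mem_fixedPointAlgebra (α : CStarDynamicalSystem G A) {a : A} :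
    a ∈ α.fixedPointAlgebra ↔ ∀ g, α.act g a = a := Iff.rfl

/-- The Ellwood map `Φ : A ⊗ A → C(G, A)`, `Φ(x ⊗ y)(g) = x α_g(y)`, on the algebraic tensor
product. -/
def ellwoodMap (α : CStarDynamicalSystem G A) : A ⊗[ℂ] A →ₗ[ℂ] C(G, A) :=
  TensorProduct.lift <| LinearMap.mk₂ ℂ
    (fun x y => (⟨fun g => x * α.act g y, continuous_const.mul (α.continuous_act y)⟩ : C(G, A)))
    (fun x x' y => by ext g; simp [add_mul])
    (fun c x y => by ext g; simp)
    (fun x y y' => by ext g; simp [mul_add])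
    (fun c x y => by ext g; simp)

theorem ellwoodMap_tmul_apply (α : CStarDynamicalSystem G A) (x y : A) (g : G) :
    α.ellwoodMap (x ⊗ₜ[ℂ] y) g = x * α.act g y := rfl

/-- Freeness in the sense of Ellwood: the Ellwood map has dense range. (For compact `G` the
topology of `C(G, A)` used here is the one of the supremum norm.) -/
def IsFree (α : CStarDynamicalSystem G A) : Prop := DenseRange α.ellwoodMap

/-- `Aut_G(A)`: the *-automorphisms of `A` that commute with the action. -/
def equivariantAut (α : CStarDynamicalSystem G A) : Subgroup (A ≃⋆ₐ[ℂ] A) where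
  carrier := {φ | ∀ g, α.act g * φ = φ * α.act g}
  mul_mem' := fun {φ ψ} hφ hψ g => by rw [← mul_assoc, hφ g, mul_assoc, hψ g, mul_assoc]
  one_mem' := fun g => by rw [mul_one, one_mul]
  inv_mem' := fun {φ} hφ g => by
    rw [eq_inv_mul_iff_mul_eq, ← mul_assoc, ← hφ g, mul_assoc, mul_inv_cancel, mul_one]

/-- The gauge group `Gau_G(A)`: the equivariant *-automorphisms of `A` that restrict to the
identity on the fixed point algebra. -/
def gaugeGroup (α : CStarDynamicalSystem G A) : Subgroup (A ≃⋆ₐ[ℂ] A) where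
  carrier := {φ | φ ∈ α.equivariantAut ∧ ∀ a ∈ α.fixedPointAlgebra, φ a = a}
  mul_mem' := fun {φ ψ} hφ hψ => ⟨mul_mem hφ.1 hψ.1, fun a ha => by
    rw [StarAlgEquiv.mul_apply, hψ.2 a ha, hφ.2 a ha]⟩
  one_mem' := ⟨one_mem _, fun _ _ => rfl⟩
  inv_mem' := fun {φ} hφ => ⟨inv_mem hφ.1, fun a ha => by
    rw [StarAlgEquiv.aut_inv]
    conv_lhs => rw [← hφ.2 a ha]
    exact φ.symm_apply_apply a⟩

end Basic

/-! ### Commutativity of the gauge group of a free action of a compact abelian group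

Needed in order to speak of group cohomology with coefficients in the gauge group. -/

section Commutativity

theorem norm_aut_apply {A : Type*} [CStarAlgebra A] (φ : A ≃⋆ₐ[ℂ] A) (x : A) : ‖φ x‖ = ‖x‖ :=
  NonUnitalStarAlgHom.norm_map φ φ.injective x

theorem continuous_aut {A : Type*} [CStarAlgebra A] (φ : A ≃⋆ₐ[ℂ] A) : Continuous φ :=
  (AddMonoidHomClass.isometry_of_norm φ (norm_aut_apply φ)).continuous

theorem aut_integral {A X : Type*} [CStarAlgebra A] [MeasurableSpace X] (μ : Measure X)
    (φ : A ≃⋆ₐ[ℂ] A) (f : X → A) (hf : Integrable f μ) :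
    φ (∫ x, f x ∂μ) = ∫ x, φ (f x) ∂μ := by
  let L : A →L[ℂ] A :=
    { toFun := φ, map_add' := map_add φ, map_smul' := map_smul φ, cont := continuous_aut φ }
  exact (L.integral_comp_comm hf).symm

theorem continuous_act_comp {Z A : Type*} [Group Z] [TopologicalSpace Z] [CStarAlgebra A]
    (θ : CStarDynamicalSystem Z A) {X : Type*} [TopologicalSpace X]
    {u : X → Z} {f : X → A} (hu : Continuous u) (hf : Continuous f) :
    Continuous fun x => θ.act (u x) (f x) := by
  rw [continuous_iff_continuousAt]
  intro x₀
  have h1 : Filter.Tendsto (fun x => θ.act (u x) (f x₀)) (nhds x₀) (nhds (θ.act (u x₀) (f x₀))) :=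
    ((θ.continuous_act (f x₀)).comp hu).tendsto x₀
  have h2 : Filter.Tendsto (fun x => θ.act (u x) (f x - f x₀)) (nhds x₀) (nhds 0) := by
    rw [tendsto_zero_iff_norm_tendsto_zero]
    simp only [norm_aut_apply]
    rw [← tendsto_zero_iff_norm_tendsto_zero]
    have := (hf.tendsto x₀).sub_const (f x₀)
    simpa using this
  have := h1.add h2
  simpa [ContinuousAt] using this

theorem integrable_of_cont {Z A : Type*} [TopologicalSpace Z] [CompactSpace Z] [CStarAlgebra A]
    [MeasurableSpace Z] [BorelSpace Z] (μ : Measure Z) [IsProbabilityMeasure μ] {f : Z → A}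
    (hf : Continuous f) : Integrable f μ :=
  hf.integrable_of_hasCompactSupport (HasCompactSupport.of_compactSpace f)

theorem continuous_integral_map {Z A : Type*} [TopologicalSpace Z] [CompactSpace Z]
    [CStarAlgebra A] [MeasurableSpace Z] [BorelSpace Z] (μ : Measure Z) [IsProbabilityMeasure μ] :
    Continuous fun f : C(Z, A) => ∫ z, f z ∂μ := by
  refine (LipschitzWith.of_dist_le_mul (K := 1) fun f g => ?_).continuous
  rw [dist_eq_norm, ← integral_sub (integrable_of_cont μ f.continuous)
    (integrable_of_cont μ g.continuous)]
  refine (norm_integral_le_of_norm_le_const (C := dist f g)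
    (Filter.Eventually.of_forall fun z => ?_)).trans (le_of_eq (by simp))
  rw [← dist_eq_norm]
  exact ContinuousMap.dist_apply_le_dist z

theorem norm_sub_le_of_integral_eq {Z A : Type*} [CStarAlgebra A] [MeasurableSpace Z]
    (μ : Measure Z) [IsProbabilityMeasure μ] {f g : Z → A} {u v : A} {C : ℝ}
    (hf : Integrable f μ) (hg : Integrable g μ) (hfg : ∫ z, f z ∂μ = ∫ z, g z ∂μ)
    (hu : ∀ z, ‖f z - u‖ ≤ C) (hv : ∀ z, ‖g z - v‖ ≤ C) : ‖v - u‖ ≤ 2 * C := by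
  have hk : ∀ {k : Z → A} {w : A}, Integrable k μ → (∀ z, ‖k z - w‖ ≤ C) →
      ‖∫ z, k z ∂μ - w‖ ≤ C := by
    intro k w hk h
    have e : ∫ z, k z ∂μ - w = ∫ z, (k z - w) ∂μ := by
      rw [integral_sub hk (integrable_const _)]; simp
    rw [e]
    exact (norm_integral_le_of_norm_le_const (Filter.Eventually.of_forall h)).trans
      (le_of_eq (by simp))
  have h1 := hk hf hu
  have h2 := hk hg hv
  rw [← hfg] at h2
  have e : v - u = (∫ z, f z ∂μ - u) - (∫ z, f z ∂μ - v) := by abel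
  rw [e]
  exact (norm_sub_le _ _).trans (by linarith)

theorem integral_act_mem {Z A : Type*} [CommGroup Z] [TopologicalSpace Z]
    [IsTopologicalGroup Z] [CompactSpace Z] [CStarAlgebra A] [MeasurableSpace Z] [BorelSpace Z]
    (θ : CStarDynamicalSystem Z A) (μ : Measure Z) [IsProbabilityMeasure μ]
    [μ.IsMulLeftInvariant] (x : A) : ∫ z, θ.act z x ∂μ ∈ θ.fixedPointAlgebra := by
  intro g
  rw [aut_integral μ _ _ (integrable_of_cont μ (θ.continuous_act x)),
    ← integral_mul_left_eq_self (fun z => θ.act z x) g]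
  simp only [map_mul, StarAlgEquiv.mul_apply]

/-- Every gauge transformation is approximated by integral operators against the action. -/
theorem exists_kernel {Z A : Type*} [CommGroup Z] [TopologicalSpace Z]
    [IsTopologicalGroup Z] [CompactSpace Z] [CStarAlgebra A] [MeasurableSpace Z] [BorelSpace Z]
    (θ : CStarDynamicalSystem Z A) (hθ : θ.IsFree) (μ : Measure Z)
    [IsProbabilityMeasure μ] [μ.IsHaarMeasure] (φ : A ≃⋆ₐ[ℂ] A) (hφ : φ ∈ θ.gaugeGroup) (a : A)
    {η : ℝ} (hη : 0 < η) :
    ∃ (F : C(Z, A)) (c : ℝ), 0 < c ∧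
      ∀ b : A, ‖b‖ = ‖a‖ → (∀ z, ‖θ.act z b - b‖ = ‖θ.act z a - a‖) →
        ‖∫ z, F z * θ.act z b ∂μ - c • φ b‖ ≤ η * c * (1 + ‖a‖) := by
  let f : C(Z, ℝ) := ⟨fun z => max 0 (η - ‖θ.act z a - a‖),
    continuous_const.max (continuous_const.sub ((θ.continuous_act a).sub continuous_const).norm)⟩
  have hfint : Integrable f μ :=
    f.continuous.integrable_of_hasCompactSupport (HasCompactSupport.of_compactSpace _)
  have hf0 : ∀ z, 0 ≤ f z := fun z => le_max_left _ _
  set c : ℝ := ∫ z, f z ∂μ with hc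
  have hcpos : 0 < c := by
    refine f.continuous.integral_pos_of_hasCompactSupport_nonneg_nonzero
      (HasCompactSupport.of_compactSpace _) hf0 (x := 1) ?_
    have : f 1 = η := by simp [f, hη.le]
    rw [this]; exact hη.ne'
  let f' : C(Z, A) := ⟨fun z => f z • (1 : A), f.continuous.smul continuous_const⟩
  obtain ⟨t, ht⟩ := hθ.exists_dist_lt f' (mul_pos hη hcpos)
  have htz : ∀ z, ‖θ.ellwoodMap t z - f z • (1 : A)‖ ≤ η * c := fun z => by
    have h := (ContinuousMap.dist_apply_le_dist (f := f') (g := θ.ellwoodMap t) z).trans ht.le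
    rwa [dist_comm, dist_eq_norm] at h
  let φl : A →ₗ[ℂ] A := { toFun := φ, map_add' := map_add φ, map_smul' := map_smul φ }
  have hcont : ∀ (k : C(Z, A)) (b : A), Continuous fun z => k z * θ.act z b := fun k b =>
    k.continuous.mul (θ.continuous_act b)
  have key : ∀ (s : A ⊗[ℂ] A) (b : A),
      ∫ z, θ.ellwoodMap (TensorProduct.map φl LinearMap.id s) z * θ.act z b ∂μ =
        φ (∫ z, θ.ellwoodMap s z * θ.act z b ∂μ) := by
    intro s b
    induction s using TensorProduct.induction_on with
    | zero => simp
    | tmul x y =>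
      have h1 : ∀ x : A, ∫ z, x * θ.act z y * θ.act z b ∂μ = x * ∫ z, θ.act z (y * b) ∂μ := by
        intro x
        rw [← integral_const_mul_of_integrable (integrable_of_cont μ (θ.continuous_act _))]
        simp only [map_mul, mul_assoc]
      simp only [TensorProduct.map_tmul, ellwoodMap_tmul_apply, LinearMap.id_apply, h1]
      rw [map_mul, hφ.2 _ (integral_act_mem θ μ (y * b))]
      rfl
    | add s s' hs hs' =>
      simp only [map_add, ContinuousMap.add_apply, add_mul]
      rw [integral_add (integrable_of_cont μ (hcont _ b)) (integrable_of_cont μ (hcont _ b)),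
        integral_add (integrable_of_cont μ (hcont _ b)) (integrable_of_cont μ (hcont _ b)),
        map_add, hs, hs']
  refine ⟨θ.ellwoodMap (TensorProduct.map φl LinearMap.id t), c, hcpos, fun b hb hbz => ?_⟩
  have hcb : c • φ b = φ (c • b) := ((φl.restrictScalars ℝ).map_smul c b).symm
  rw [key, hcb, ← map_sub, norm_aut_apply, hc, ← integral_smul_const,
    ← integral_sub (integrable_of_cont μ (hcont _ b)) (hfint.smul_const b)]
  have hbound : ∀ z, ‖θ.ellwoodMap t z * θ.act z b - f z • b‖ ≤ η * c * ‖a‖ + η * f z := by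
    intro z
    have e : θ.ellwoodMap t z * θ.act z b - f z • b =
        (θ.ellwoodMap t z - f z • (1 : A)) * θ.act z b + f z • (θ.act z b - b) := by
      rw [sub_mul, smul_mul_assoc, one_mul, smul_sub]; abel
    rw [e]
    refine (norm_add_le _ _).trans (add_le_add ?_ ?_)
    · refine (norm_mul_le _ _).trans ?_
      rw [norm_aut_apply, hb]
      exact mul_le_mul_of_nonneg_right (htz z) (norm_nonneg _)
    · rw [norm_smul, Real.norm_of_nonneg (hf0 z), hbz z, mul_comm]
      by_cases h : ‖θ.act z a - a‖ ≤ η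
      · exact mul_le_mul_of_nonneg_right h (hf0 z)
      · have : f z = 0 := max_eq_left (by linarith)
        simp [this]
  refine (norm_integral_le_of_norm_le ((integrable_const _).add (hfint.const_mul η))
    (Filter.Eventually.of_forall hbound)).trans (le_of_eq ?_)
  simp only [Pi.add_apply]
  rw [integral_add (integrable_const _) (hfint.const_mul η), integral_const, integral_const_mul]
  simp only [probReal_univ, one_smul]
  rw [← hc]
  ring

theorem gaugeGroup_mul_comm {Z A : Type*} [CommGroup Z] [TopologicalSpace Z]
    [IsTopologicalGroup Z] [CompactSpace Z] [CStarAlgebra A]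
    (θ : CStarDynamicalSystem Z A) (hθ : θ.IsFree)
    {φ ψ : A ≃⋆ₐ[ℂ] A} (hφ : φ ∈ θ.gaugeGroup) (hψ : ψ ∈ θ.gaugeGroup) : φ * ψ = ψ * φ := by
  borelize Z
  let μ : Measure Z := Measure.haarMeasure ⊤
  have : IsProbabilityMeasure μ := ⟨Measure.haarMeasure_self⟩
  ext a
  simp only [StarAlgEquiv.mul_apply]
  have hcomm : ∀ {χ : A ≃⋆ₐ[ℂ] A}, χ ∈ θ.gaugeGroup → ∀ (z : Z) (x : A),
      θ.act z (χ x) = χ (θ.act z x) := fun hχ z x => DFunLike.congr_fun (hχ.1 z) x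
  have hact : ∀ (z w : Z) (x : A), θ.act z (θ.act w x) = θ.act w (θ.act z x) := fun z w x => by
    rw [← StarAlgEquiv.mul_apply, ← map_mul, mul_comm, map_mul, StarAlgEquiv.mul_apply]
  have hinv : ∀ (w : Z) (x : A), θ.act w (θ.act w⁻¹ x) = x := fun w x => by
    rw [← StarAlgEquiv.mul_apply, ← map_mul, mul_inv_cancel, map_one]; rfl
  -- it suffices to bound the difference by an arbitrarily small number
  suffices h : ∀ η : ℝ, 0 < η → ‖φ (ψ a) - ψ (φ a)‖ ≤ η * (2 * (1 + ‖a‖)) by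
    rw [← sub_eq_zero, ← norm_le_zero_iff]
    refine le_of_forall_pos_le_add fun ε hε => ?_
    have hpos : 0 < 2 * (1 + ‖a‖) := by positivity
    refine (h (ε / (2 * (1 + ‖a‖))) (by positivity)).trans (le_of_eq ?_)
    field_simp
    ring
  intro η hη
  obtain ⟨F, c, hc, hF⟩ := exists_kernel θ hθ μ φ hφ a hη
  have hcont : ∀ b : A, Continuous fun p : Z × Z => θ.act p.1 (F p.2) * θ.act p.2 b := fun b =>
    (continuous_act_comp θ continuous_fst (F.continuous.comp continuous_snd)).mul
      ((θ.continuous_act b).comp continuous_snd)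
  have hcont' : ∀ b : A, Continuous fun p : Z × Z => ψ (θ.act p.1 (F p.2)) * θ.act p.2 b :=
    fun b => ((continuous_aut ψ).comp
      (continuous_act_comp θ continuous_fst (F.continuous.comp continuous_snd))).mul
      ((θ.continuous_act b).comp continuous_snd)
  have hsec : ∀ {k : Z × Z → A}, Continuous k → ∀ w, Integrable (fun z => k (w, z)) μ :=
    fun hk w => integrable_of_cont μ (hk.comp (Continuous.prodMk_right w))
  -- the translated kernels approximate `φ` as well
  have hK : ∀ b : A, ‖b‖ = ‖a‖ → (∀ z, ‖θ.act z b - b‖ = ‖θ.act z a - a‖) → ∀ w : Z,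
      ‖∫ z, θ.act w (F z) * θ.act z b ∂μ - c • φ b‖ ≤ η * c * (1 + ‖a‖) := by
    intro b hb hbz w
    have h := hF (θ.act w⁻¹ b) (by rw [norm_aut_apply, hb]) (fun z => by
      rw [hact, ← map_sub, norm_aut_apply, hbz])
    rw [← norm_aut_apply (θ.act w), map_sub, aut_integral μ (θ.act w) (fun z => F z * θ.act z (θ.act w⁻¹ b))
      (integrable_of_cont μ (F.continuous.mul (θ.continuous_act _)))] at h
    have e : θ.act w (c • φ (θ.act w⁻¹ b)) = c • φ b := by
      rw [← Complex.coe_smul, ← Complex.coe_smul, map_smul, hcomm hφ, hinv]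
    rw [e] at h
    simpa only [map_mul, hact _ w⁻¹ b, hinv] using h
  have hψz : ∀ z, ‖θ.act z (ψ a) - ψ a‖ = ‖θ.act z a - a‖ := fun z => by
    rw [hcomm hψ, ← map_sub, norm_aut_apply]
  have h1 : ∀ w, ‖∫ z, θ.act w (F z) * θ.act z (ψ a) ∂μ - c • φ (ψ a)‖ ≤ η * c * (1 + ‖a‖) :=
    hK (ψ a) (norm_aut_apply ψ a) hψz
  have h2 : ∀ w, ‖∫ z, ψ (θ.act w (F z)) * θ.act z (ψ a) ∂μ - c • ψ (φ a)‖ ≤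
      η * c * (1 + ‖a‖) := by
    intro w
    have h := hK a rfl (fun _ => rfl) w
    rw [← norm_aut_apply ψ, map_sub, aut_integral μ _ _ (hsec (hcont a) w)] at h
    have e : ψ (c • φ a) = c • ψ (φ a) := by
      rw [← Complex.coe_smul, ← Complex.coe_smul, map_smul]
    rw [e] at h
    simpa only [map_mul, hcomm hψ] using h
  -- averaging over the translations removes `ψ` from the kernel
  have hav : ∫ w, ∫ z, ψ (θ.act w (F z)) * θ.act z (ψ a) ∂μ ∂μ =
      ∫ w, ∫ z, θ.act w (F z) * θ.act z (ψ a) ∂μ ∂μ := by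
    rw [integral_integral_swap_of_hasCompactSupport
        (f := fun w z => ψ (θ.act w (F z)) * θ.act z (ψ a)) (hcont' (ψ a))
        (HasCompactSupport.of_compactSpace _),
      integral_integral_swap_of_hasCompactSupport
        (f := fun w z => θ.act w (F z) * θ.act z (ψ a)) (hcont (ψ a))
        (HasCompactSupport.of_compactSpace _)]
    congr 1
    ext z
    have hi := integrable_of_cont μ (θ.continuous_act (F z))
    have hi' : Integrable (fun w => ψ (θ.act w (F z))) μ :=
      integrable_of_cont μ ((continuous_aut ψ).comp (θ.continuous_act (F z)))
    rw [integral_mul_const_of_integrable hi']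
    rw [integral_mul_const_of_integrable hi, ← aut_integral μ _ _ hi,
      hψ.2 _ (integral_act_mem θ μ (F z))]
  have hint : ∀ {k : Z × Z → A}, Continuous k → Integrable (fun w => ∫ z, k (w, z) ∂μ) μ := by
    intro k hk
    exact integrable_of_cont μ
      ((continuous_integral_map μ).comp (ContinuousMap.curry ⟨k, hk⟩).continuous)
  have hfin : ‖c • φ (ψ a) - c • ψ (φ a)‖ ≤ 2 * (η * c * (1 + ‖a‖)) :=
    norm_sub_le_of_integral_eq μ
      (hint (k := fun p => ψ (θ.act p.1 (F p.2)) * θ.act p.2 (ψ a)) (hcont' (ψ a)))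
      (hint (k := fun p => θ.act p.1 (F p.2) * θ.act p.2 (ψ a)) (hcont (ψ a))) hav h2 h1
  rw [← smul_sub, norm_smul, Real.norm_of_nonneg hc.le] at hfin
  refine le_of_mul_le_mul_left (hfin.trans (le_of_eq ?_)) hc
  ring

/-- The gauge group of a free action of a compact abelian group is abelian. -/
abbrev gaugeCommGroup {Z A : Type*} [CommGroup Z] [TopologicalSpace Z]
    [IsTopologicalGroup Z] [CompactSpace Z] [CStarAlgebra A]
    (θ : CStarDynamicalSystem Z A) (hθ : θ.IsFree) : CommGroup θ.gaugeGroup :=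
  { (inferInstance : Group θ.gaugeGroup) with
    mul_comm := fun φ ψ => Subtype.ext (gaugeGroup_mul_comm θ hθ φ.2 ψ.2) }

end Commutativity

/-! ### Conjugation on the gauge group -/

section Conjugation

variable {G A : Type*} [Group G] [TopologicalSpace G] [CStarAlgebra A]

theorem conj_mem_gaugeGroup (θ : CStarDynamicalSystem G A) {ψ φ : A ≃⋆ₐ[ℂ] A}
    (hψ : ψ ∈ θ.equivariantAut) (hφ : φ ∈ θ.gaugeGroup) : ψ * φ * ψ⁻¹ ∈ θ.gaugeGroup := by
  refine ⟨mul_mem (mul_mem hψ hφ.1) (inv_mem hψ), fun a ha => ?_⟩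
  have h1 : ψ⁻¹ a ∈ θ.fixedPointAlgebra := fun g => by
    have h := DFunLike.congr_fun (inv_mem hψ g) a
    simp only [StarAlgEquiv.mul_apply] at h
    rw [h, ha g]
  rw [StarAlgEquiv.mul_apply, StarAlgEquiv.mul_apply, hφ.2 _ h1, ← StarAlgEquiv.mul_apply,
    mul_inv_cancel]
  rfl

/-- The action of the equivariant automorphisms on the gauge group by conjugation,
`φ ↦ ψ ∘ φ ∘ ψ⁻¹`. -/
def gaugeConj (θ : CStarDynamicalSystem G A) : θ.equivariantAut →* MulAut θ.gaugeGroup where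
  toFun ψ :=
    { toFun := fun φ => ⟨ψ.1 * φ.1 * ψ.1⁻¹, conj_mem_gaugeGroup θ ψ.2 φ.2⟩
      invFun := fun φ => ⟨ψ.1⁻¹ * φ.1 * ψ.1⁻¹⁻¹, conj_mem_gaugeGroup θ (inv_mem ψ.2) φ.2⟩
      left_inv := fun φ => Subtype.ext (by group)
      right_inv := fun φ => Subtype.ext (by group)
      map_mul' := fun φ φ' => Subtype.ext (by simp only [Subgroup.coe_mul]; group) }
  map_one' := by ext1 φ; exact Subtype.ext (by simp)
  map_mul' ψ ψ' := by ext1 φ; exact Subtype.ext (by simp [mul_assoc])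

theorem coe_gaugeConj_apply (θ : CStarDynamicalSystem G A) (ψ : θ.equivariantAut)
    (φ : θ.gaugeGroup) : (θ.gaugeConj ψ φ : A ≃⋆ₐ[ℂ] A) = ψ.1 * φ.1 * ψ.1⁻¹ := rfl

end Conjugation

end CStarDynamicalSystem

/-! ## Second cohomology of a group with twisted abelian coefficients -/

section Cohomology

variable {G M : Type*} [Group G] [CommGroup M]

/-- `Z²_S(G, M)`: the 2-cocycles of `G` with values in the abelian group `M` (written
multiplicatively) on which `G` acts through `S`. -/
def twistedCocycles₂ (S : G →* MulAut M) : Subgroup (G × G → M) where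
  carrier := {ω | ∀ g h k, S g (ω (h, k)) * ω (g, h * k) = ω (g, h) * ω (g * h, k)}
  one_mem' := fun g h k => by simp
  mul_mem' := fun {ω ω'} hω hω' g h k => by
    simp only [Pi.mul_apply, map_mul]
    rw [mul_mul_mul_comm, hω, hω', mul_mul_mul_comm]
  inv_mem' := fun {ω} hω g h k => by
    simp only [Pi.inv_apply, map_inv]
    rw [← mul_inv, ← mul_inv, hω]

/-- The coboundary `(d_S f)(g, h) = f(g) · S(g)(f(h)) · f(gh)⁻¹` of a map `f : G → M`. -/
def twistedCoboundary (S : G →* MulAut M) : (G → M) →* (G × G → M) where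
  toFun f p := f p.1 * S p.1 (f p.2) * (f (p.1 * p.2))⁻¹
  map_one' := by ext p; simp
  map_mul' f f' := by
    ext p
    simp only [Pi.mul_apply, map_mul, mul_inv]
    rw [mul_mul_mul_comm (f p.1), mul_mul_mul_comm (f p.1 * _)]

/-- `B²_S(G, M)`: the 2-coboundaries. -/
def twistedCoboundaries₂ (S : G →* MulAut M) : Subgroup (G × G → M) := (twistedCoboundary S).range

/-- `H²_S(G, M) = Z²_S(G, M) / B²_S(G, M)`. (The coboundaries are cocycles, see
`twistedCoboundaries₂_le`.) -/
abbrev TwistedH₂ (S : G →* MulAut M) : Type _ :=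
  twistedCocycles₂ S ⧸ (twistedCoboundaries₂ S).subgroupOf (twistedCocycles₂ S)

theorem twistedCoboundaries₂_le (S : G →* MulAut M) :
    twistedCoboundaries₂ S ≤ twistedCocycles₂ S := by
  rintro _ ⟨f, rfl⟩ g h k
  simp only [twistedCoboundary, MonoidHom.coe_mk, OneHom.coe_mk, map_mul, map_inv,
    MulAut.mul_apply, mul_assoc]
  have h1 := mul_comm ((S g) (f (h * k)))⁻¹ (S g (f (h * k)) * (f (g * (h * k)))⁻¹)
  rw [mul_assoc, mul_comm _ ((S g) (f (h * k)))⁻¹, inv_mul_cancel_left] at h1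
  have e : ∀ a b c d u v : M, a * (b * (c⁻¹ * (d * (c * u)))) = d * (a * (v⁻¹ * (v * (b * u)))) := by
    intro a b c d u v
    rw [mul_left_comm d c u, inv_mul_cancel_left, inv_mul_cancel_left, mul_left_comm b d u,
      mul_left_comm a d]
  exact e _ _ _ _ _ _

end Cohomology

/-! ## Central extensions and lifts -/

/-- A central extension `1 → Z → Ĝ → G → 1` of topological groups. (For compact Hausdorff groups
`ι` is then automatically a topological embedding and `q` a quotient map.) -/
structure CentralExtension (Z Ghat G : Type*) [Group Z] [TopologicalSpace Z]
    [Group Ghat] [TopologicalSpace Ghat] [Group G] [TopologicalSpace G] where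
  /-- the inclusion `ι : Z → Ĝ` -/
  ι : Z →* Ghat
  /-- the quotient map `q : Ĝ → G` -/
  q : Ghat →* G
  continuous_ι : Continuous ι
  continuous_q : Continuous q
  injective_ι : Function.Injective ι
  surjective_q : Function.Surjective q
  exact : ι.range = q.ker
  central : ι.range ≤ Subgroup.center Ghat

/-- The *-homomorphism `j : A → Â` identifies `A` with the fixed point algebra of `(Â, Z, θ)`, i.e.
`(Â, Z, θ)` is a C*-dynamical system over `A`. -/
structure IsFixedPointEmbedding {Z A Ahat : Type*} [Group Z] [TopologicalSpace Z] [CStarAlgebra A]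
    [CStarAlgebra Ahat] (θ : CStarDynamicalSystem Z Ahat) (j : A →⋆ₐ[ℂ] Ahat) : Prop where
  injective : Function.Injective j
  range_eq : j.range = θ.fixedPointAlgebra

/-- `Aut(A)_[Â]`: the *-automorphisms of `A` that can be lifted to elements of `Aut_Z(Â)`. -/
def liftableAut {Z A Ahat : Type*} [Group Z] [TopologicalSpace Z] [CStarAlgebra A]
    [CStarAlgebra Ahat] (θ : CStarDynamicalSystem Z Ahat) (j : A →⋆ₐ[ℂ] Ahat) :
    Subgroup (A ≃⋆ₐ[ℂ] A) where
  carrier := {φ | ∃ φhat ∈ θ.equivariantAut, ∀ a, φhat (j a) = j (φ a)}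
  one_mem' := ⟨1, one_mem _, fun _ => rfl⟩
  mul_mem' := by
    rintro φ ψ ⟨φhat, hφ, hφj⟩ ⟨ψhat, hψ, hψj⟩
    exact ⟨φhat * ψhat, mul_mem hφ hψ, fun a => by simp [StarAlgEquiv.mul_apply, hφj, hψj]⟩
  inv_mem' := by
    rintro φ ⟨φhat, hφ, hφj⟩
    refine ⟨φhat⁻¹, inv_mem hφ, fun a => φhat.injective ?_⟩
    change φhat (φhat⁻¹ (j a)) = φhat (j (φ⁻¹ a))
    rw [← StarAlgEquiv.mul_apply, mul_inv_cancel, hφj, ← StarAlgEquiv.mul_apply, mul_inv_cancel]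
    rfl

section Lifting

variable {Z Ghat G A Ahat : Type*}
  [CommGroup Z] [TopologicalSpace Z] [Group Ghat] [TopologicalSpace Ghat]
  [Group G] [TopologicalSpace G] [CStarAlgebra A] [CStarAlgebra Ahat]

/-- The four conditions on a map `α̂ : Ĝ → Aut(Â)` (not assumed to be a homomorphism). -/
structure LiftingConditions (E : CentralExtension Z Ghat G) (α : CStarDynamicalSystem G A)
    (θ : CStarDynamicalSystem Z Ahat) (j : A →⋆ₐ[ℂ] Ahat)
    (αhat : Ghat → (Ahat ≃⋆ₐ[ℂ] Ahat)) : Prop where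
  /-- Condition 1, first part: `α̂_e = id` -/
  map_one : αhat 1 = 1
  /-- Condition 1, second part: `α̂(Ĝ) ⊆ Aut_Z(Â)` -/
  mem_equivariantAut : ∀ g, αhat g ∈ θ.equivariantAut
  /-- Condition 2: `α̂` is a lift of `α` -/
  lift : ∀ g a, αhat g (j a) = j (α.act (E.q g) a)
  /-- Condition 3: `α̂` restricts to `θ` on `Z` -/
  restrict : ∀ z, αhat (E.ι z) = θ.act z
  /-- Condition 4: `α̂_{zg} = α̂_z ∘ α̂_g` -/
  map_ι_mul : ∀ z g, αhat (E.ι z * g) = αhat (E.ι z) * αhat g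

namespace LiftingConditions

variable {E : CentralExtension Z Ghat G} {α : CStarDynamicalSystem G A}
  {θ : CStarDynamicalSystem Z Ahat} {j : A →⋆ₐ[ℂ] Ahat} {αhat : Ghat → (Ahat ≃⋆ₐ[ℂ] Ahat)}

/-- `α̂_g` as an element of `Aut_Z(Â)`. -/
def equiv (h : LiftingConditions E α θ j αhat) (g : Ghat) : θ.equivariantAut :=
  ⟨αhat g, h.mem_equivariantAut g⟩

theorem act_comm (h : LiftingConditions E α θ j αhat) (z : Z) (g : Ghat) :
    θ.act z * αhat g = αhat g * θ.act z := h.mem_equivariantAut g z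

theorem exists_eq_of_q_eq (h : LiftingConditions E α θ j αhat) {g g' : Ghat}
    (hq : E.q g' = E.q g) : ∃ z, g' = E.ι z * g ∧ αhat g' = θ.act z * αhat g := by
  have hm : g' * g⁻¹ ∈ E.ι.range := by
    rw [E.exact, MonoidHom.mem_ker, map_mul, map_inv, hq, mul_inv_cancel]
  obtain ⟨z, hz⟩ := hm
  have e : g' = E.ι z * g := by rw [hz]; group
  exact ⟨z, e, by rw [e, h.map_ι_mul, h.restrict]⟩

theorem act_mem_gaugeGroup (θ : CStarDynamicalSystem Z Ahat) (z : Z) :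
    θ.act z ∈ θ.gaugeGroup :=
  ⟨fun w => by rw [← map_mul, mul_comm, map_mul], fun a ha => ha z⟩

/-- Conjugation by `α̂_g` on the gauge group depends only on `q(g)`. -/
theorem gaugeConj_eq_of_q_eq (h : LiftingConditions E α θ j αhat) {g g' : Ghat}
    (hq : E.q g' = E.q g) : θ.gaugeConj (h.equiv g') = θ.gaugeConj (h.equiv g) := by
  obtain ⟨z, -, hz⟩ := h.exists_eq_of_q_eq hq
  ext1 φ
  apply Subtype.ext
  have hm := (CStarDynamicalSystem.conj_mem_gaugeGroup θ (h.mem_equivariantAut g) φ.2).1 z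
  simp only [CStarDynamicalSystem.coe_gaugeConj_apply, equiv, hz]
  rw [mul_inv_rev, mul_assoc (θ.act z), mul_assoc (θ.act z), ← mul_assoc _ (αhat g)⁻¹, ← mul_assoc,
    hm, mul_assoc, mul_inv_cancel, mul_one]

/-- `α̂_g ∘ α̂_g' ∘ α̂_{gg'}⁻¹` is a gauge transformation. -/
theorem defect_mem (h : LiftingConditions E α θ j αhat) (hj : IsFixedPointEmbedding θ j)
    (g g' : Ghat) : αhat g * αhat g' * (αhat (g * g'))⁻¹ ∈ θ.gaugeGroup := by
  refine ⟨mul_mem (mul_mem (h.mem_equivariantAut g) (h.mem_equivariantAut g'))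
    (inv_mem (h.mem_equivariantAut _)), fun x hx => ?_⟩
  rw [← hj.range_eq] at hx
  obtain ⟨a, rfl⟩ := hx
  obtain ⟨b, rfl⟩ := (α.act (E.q (g * g'))).surjective a
  have e : (αhat (g * g'))⁻¹ (j (α.act (E.q (g * g')) b)) = j b := by
    rw [← h.lift, ← StarAlgEquiv.mul_apply, inv_mul_cancel]; rfl
  change αhat g (αhat g' ((αhat (g * g'))⁻¹ (j (α.act (E.q (g * g')) b)))) =
    j (α.act (E.q (g * g')) b)
  rw [e, h.lift, h.lift, map_mul, map_mul, StarAlgEquiv.mul_apply]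

/-- The defect depends only on the images of its arguments in `G`. -/
theorem defect_eq_of_q_eq (h : LiftingConditions E α θ j αhat) {g g' k k' : Ghat}
    (hg : E.q g' = E.q g) (hk : E.q k' = E.q k) :
    αhat g' * αhat k' * (αhat (g' * k'))⁻¹ = αhat g * αhat k * (αhat (g * k))⁻¹ := by
  obtain ⟨z, hz, hz'⟩ := h.exists_eq_of_q_eq hg
  obtain ⟨w, hw, hw'⟩ := h.exists_eq_of_q_eq hk
  have hc : g * E.ι w = E.ι w * g :=
    Subgroup.mem_center_iff.mp (E.central ⟨w, rfl⟩) g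
  have e : g' * k' = E.ι (z * w) * (g * k) := by
    rw [hz, hw, map_mul, mul_assoc, ← mul_assoc g, hc]; simp only [mul_assoc]
  have h1 : αhat g' * αhat k' = θ.act (z * w) * (αhat g * αhat k) := by
    rw [hz', hw', map_mul, mul_assoc, ← mul_assoc (αhat g), ← h.act_comm]; simp only [mul_assoc]
  have h2 := (mul_mem (mul_mem (h.mem_equivariantAut g) (h.mem_equivariantAut k))
    (inv_mem (h.mem_equivariantAut (g * k)))) (z * w)
  rw [e, h.map_ι_mul, h.restrict, h1, mul_inv_rev, mul_assoc, ← mul_assoc (αhat g * αhat k),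
    ← mul_assoc, h2, mul_assoc, mul_inv_cancel, mul_one]

/-- The 2-cochain `δ_{α̂,G}(g, g') = α̂_ĝ ∘ α̂_ĝ' ∘ α̂_{ĝĝ'}⁻¹`, where `ĝ, ĝ'` are any preimages of
`g, g'` under `q` (see `cochain_apply`). -/
def cochain (h : LiftingConditions E α θ j αhat) (hj : IsFixedPointEmbedding θ j) :
    G × G → θ.gaugeGroup := fun p =>
  ⟨_, h.defect_mem hj (Function.surjInv E.surjective_q p.1) (Function.surjInv E.surjective_q p.2)⟩

theorem cochain_apply (h : LiftingConditions E α θ j αhat) (hj : IsFixedPointEmbedding θ j)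
    (g g' : Ghat) :
    (h.cochain hj (E.q g, E.q g') : Ahat ≃⋆ₐ[ℂ] Ahat) =
      αhat g * αhat g' * (αhat (g * g'))⁻¹ :=
  h.defect_eq_of_q_eq (Function.surjInv_eq E.surjective_q _)
    (Function.surjInv_eq E.surjective_q _)

section Free

variable [IsTopologicalGroup Z] [CompactSpace Z]

theorem gaugeConj_eq_one (hθ : θ.IsFree) (ψ : θ.equivariantAut)
    (hψ : ψ.1 ∈ θ.gaugeGroup) : θ.gaugeConj ψ = 1 := by
  ext1 φ
  apply Subtype.ext
  rw [CStarDynamicalSystem.coe_gaugeConj_apply,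
    CStarDynamicalSystem.gaugeGroup_mul_comm θ hθ hψ φ.2, mul_assoc, mul_inv_cancel, mul_one]
  rfl

theorem gaugeConj_equiv_mul (h : LiftingConditions E α θ j αhat) (hj : IsFixedPointEmbedding θ j)
    (hθ : θ.IsFree) (g g' : Ghat) :
    θ.gaugeConj (h.equiv (g * g')) = θ.gaugeConj (h.equiv g) * θ.gaugeConj (h.equiv g') := by
  have e := gaugeConj_eq_one hθ (h.equiv g * h.equiv g' * (h.equiv (g * g'))⁻¹)
    (h.defect_mem hj g g')
  rw [map_mul, map_mul, map_inv, mul_inv_eq_one] at e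
  exact e.symm

/-- The action `S : G → Aut(Gau_Z(Â))`, `S(g)(φ) = α̂_ĝ ∘ φ ∘ α̂_ĝ⁻¹`, where `ĝ` is any preimage
of `g` under `q` (see `S_apply`). -/
def S (h : LiftingConditions E α θ j αhat) (hj : IsFixedPointEmbedding θ j) (hθ : θ.IsFree) :
    G →* MulAut θ.gaugeGroup :=
  MonoidHom.mk' (fun g => θ.gaugeConj (h.equiv (Function.surjInv E.surjective_q g)))
    fun g g' => by
      rw [← h.gaugeConj_equiv_mul hj hθ]
      exact h.gaugeConj_eq_of_q_eq (by simp only [map_mul, Function.surjInv_eq])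

theorem S_apply (h : LiftingConditions E α θ j αhat) (hj : IsFixedPointEmbedding θ j)
    (hθ : θ.IsFree) (g : Ghat) (φ : θ.gaugeGroup) :
    (h.S hj hθ (E.q g) φ : Ahat ≃⋆ₐ[ℂ] Ahat) = αhat g * φ * (αhat g)⁻¹ := by
  have e : h.S hj hθ (E.q g) = θ.gaugeConj (h.equiv g) :=
    h.gaugeConj_eq_of_q_eq (Function.surjInv_eq E.surjective_q _)
  rw [e]
  rfl

/-- `H²_S(G, Gau_Z(Â))`. -/
def GaugeH₂ (h : LiftingConditions E α θ j αhat) (hj : IsFixedPointEmbedding θ j)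
    (hθ : θ.IsFree) : Type _ :=
  letI := θ.gaugeCommGroup hθ
  TwistedH₂ (h.S hj hθ)

instance (h : LiftingConditions E α θ j αhat) (hj : IsFixedPointEmbedding θ j)
    (hθ : θ.IsFree) : CommGroup (h.GaugeH₂ hj hθ) :=
  letI := θ.gaugeCommGroup hθ
  inferInstanceAs (CommGroup (TwistedH₂ (h.S hj hθ)))

theorem cochain_mem_cocycles (h : LiftingConditions E α θ j αhat)
    (hj : IsFixedPointEmbedding θ j) (hθ : θ.IsFree) :
    letI := θ.gaugeCommGroup hθ
    h.cochain hj ∈ twistedCocycles₂ (h.S hj hθ) := by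
  intro g₀ k₀ l₀
  obtain ⟨g, rfl⟩ := E.surjective_q g₀
  obtain ⟨k, rfl⟩ := E.surjective_q k₀
  obtain ⟨l, rfl⟩ := E.surjective_q l₀
  apply Subtype.ext
  change (h.S hj hθ (E.q g) (h.cochain hj (E.q k, E.q l)) : Ahat ≃⋆ₐ[ℂ] Ahat) *
      (h.cochain hj (E.q g, E.q k * E.q l) : Ahat ≃⋆ₐ[ℂ] Ahat) =
    (h.cochain hj (E.q g, E.q k) : Ahat ≃⋆ₐ[ℂ] Ahat) *
      (h.cochain hj (E.q g * E.q k, E.q l) : Ahat ≃⋆ₐ[ℂ] Ahat)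
  rw [← map_mul, ← map_mul, h.S_apply, h.cochain_apply, h.cochain_apply, h.cochain_apply,
    h.cochain_apply, mul_assoc g k l]
  group

/-- The class `[δ_{α̂,G}] ∈ H²_S(G, Gau_Z(Â))`. -/
def obstructionClass (h : LiftingConditions E α θ j αhat) (hj : IsFixedPointEmbedding θ j)
    (hθ : θ.IsFree) : h.GaugeH₂ hj hθ :=
  letI := θ.gaugeCommGroup hθ
  QuotientGroup.mk (⟨h.cochain hj, h.cochain_mem_cocycles hj hθ⟩ : twistedCocycles₂ (h.S hj hθ))

end Free

end LiftingConditions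

end Lifting

end

/-! The defect of `α̂` from being multiplicative is the cocycle `δ(g, g') = α̂_ĝ α̂_ĝ' α̂_{ĝĝ'}⁻¹`,
with values in the gauge group. If its class vanishes, then `δ(g, g') = f(g) · S(g)(f(g')) ·
f(gg')⁻¹` for some `f : G → Gau_Z(Â)`, and the defect is removed by twisting: `β_ĝ = f(q ĝ)⁻¹ ∘
α̂_ĝ`. Indeed, moving `f(g')⁻¹` past `α̂_ĝ` turns it into `S(g)(f(g'))⁻¹`, so `β_ĝ β_ĝ' = f(g)⁻¹ ·
S(g)(f(g'))⁻¹ · δ(g, g') · α̂_{ĝĝ'} = f(gg')⁻¹ α̂_{ĝĝ'} = β_{ĝĝ'}`. The cancellation in the middle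
uses that the gauge group is abelian, which `gaugeGroup_mul_comm` derives from the freeness of `θ`.

The twist preserves both boundary conditions. Gauge transformations are trivial on `A`, so `β` still
lifts `α`. The correction factors through `q`, so on `Z` it is the constant `f(1)⁻¹`, and `f(1) =
id` because `α̂_e = id` forces `δ(1, 1) = id`.

The cochain `f` comes from abstract group cohomology and is an arbitrary map, so the argument gives
no continuity of `β`. The two carrying lemmas are `exists_defect_eq_of_obstructionClass_eq_one`,
which extracts `f`, and `corrected_mul`, which is the computation above. -/

namespace LiftingConditions

variable {Z Ghat G A Ahat : Type*}
  [CommGroup Z] [TopologicalSpace Z] [IsTopologicalGroup Z] [CompactSpace Z]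
  [Group Ghat] [TopologicalSpace Ghat] [Group G] [TopologicalSpace G]
  [CStarAlgebra A] [CStarAlgebra Ahat]
  {E : CentralExtension Z Ghat G} {α : CStarDynamicalSystem G A}
  {θ : CStarDynamicalSystem Z Ahat} {j : A →⋆ₐ[ℂ] Ahat} {αhat : Ghat → (Ahat ≃⋆ₐ[ℂ] Ahat)}

/-! ### Trivialising the cocycle and twisting by the trivialising cochain -/

/-- If the obstruction class is trivial, the defect of `α̂` is the coboundary of a map
`f : G → Gau_Z(Â)`. -/
theorem exists_defect_eq_of_obstructionClass_eq_one (h : LiftingConditions E α θ j αhat)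
    (hj : IsFixedPointEmbedding θ j) (hθ : θ.IsFree) (hclass : h.obstructionClass hj hθ = 1) :
    ∃ f : G → θ.gaugeGroup, ∀ g k : Ghat,
      αhat g * αhat k * (αhat (g * k))⁻¹ =
        (f (E.q g)).1 * (αhat g * (f (E.q k)).1 * (αhat g)⁻¹) * (f (E.q g * E.q k)).1⁻¹ := by
  -- The cohomology group is formed with this commutative structure. It extends the existing group
  -- structure, so products of gauge transformations keep their meaning as compositions.
  let _ := θ.gaugeCommGroup hθ
  -- `hclass` is an equation in `GaugeH₂`, which is this quotient by definition. Naming the subgroup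
  -- and the representative lets it be used there.
  have hmem := (QuotientGroup.eq_one_iff
    (N := (twistedCoboundaries₂ (h.S hj hθ)).subgroupOf (twistedCocycles₂ (h.S hj hθ)))
    (⟨h.cochain hj, h.cochain_mem_cocycles hj hθ⟩ : twistedCocycles₂ (h.S hj hθ))).mp hclass
  obtain ⟨f, hf⟩ := Subgroup.mem_subgroupOf.mp hmem
  refine ⟨f, fun g k => ?_⟩
  -- Both sides are expressed through `G` alone, independently of the preimages `g` and `k`. What
  -- remains is the coboundary equation at `(E.q g, E.q k)`.
  rw [← h.cochain_apply hj, ← h.S_apply hj hθ]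
  exact congrArg Subtype.val (congrFun hf (E.q g, E.q k)).symm

/-- Correcting `α̂` by a cochain whose coboundary is the defect of `α̂` gives a homomorphism. -/
theorem corrected_mul (h : LiftingConditions E α θ j αhat) (hθ : θ.IsFree)
    {f : G → θ.gaugeGroup}
    (hf : ∀ g k : Ghat, αhat g * αhat k * (αhat (g * k))⁻¹ =
      (f (E.q g)).1 * (αhat g * (f (E.q k)).1 * (αhat g)⁻¹) * (f (E.q g * E.q k)).1⁻¹)
    (g k : Ghat) :
    (f (E.q (g * k))).1⁻¹ * αhat (g * k) =
      ((f (E.q g)).1⁻¹ * αhat g) * ((f (E.q k)).1⁻¹ * αhat k) := by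
  -- The conjugate of `f (E.q k)` by `αhat g` is again a gauge transformation, hence commutes with
  -- `f (E.q g)`. The coboundary has these two factors in the order opposite to the one in which
  -- their inverses cancel them.
  have hcomm := θ.gaugeGroup_mul_comm hθ (f (E.q g)).2
    (θ.conj_mem_gaugeGroup (h.mem_equivariantAut g) (f (E.q k)).2)
  have e := mul_inv_eq_iff_eq_mul.mp (hf g k)
  rw [hcomm] at e
  rw [map_mul]
  -- With `F` for `f (E.q g)` and `C` for the conjugate of `f (E.q k)`, the trivial factor `F⁻¹ C⁻¹
  -- C F` is inserted so that the right-hand side of `e` appears.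
  calc (f (E.q g * E.q k)).1⁻¹ * αhat (g * k)
      = (f (E.q g)).1⁻¹ * (αhat g * (f (E.q k)).1 * (αhat g)⁻¹)⁻¹ *
          (αhat g * (f (E.q k)).1 * (αhat g)⁻¹ * (f (E.q g)).1 *
            (f (E.q g * E.q k)).1⁻¹ * αhat (g * k)) := by group
    _ = (f (E.q g)).1⁻¹ * (αhat g * (f (E.q k)).1 * (αhat g)⁻¹)⁻¹ * (αhat g * αhat k) := by
        rw [← e]
    _ = ((f (E.q g)).1⁻¹ * αhat g) * ((f (E.q k)).1⁻¹ * αhat k) := by group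

end LiftingConditions

/-! ### The lifted action of `Ĝ` -/

theorem mainTheorem5 {Z Ghat G A Ahat : Type*}
    [CommGroup Z] [TopologicalSpace Z] [IsTopologicalGroup Z] [CompactSpace Z] [T2Space Z]
    [Group Ghat] [TopologicalSpace Ghat] [IsTopologicalGroup Ghat] [CompactSpace Ghat]
    [T2Space Ghat]
    [Group G] [TopologicalSpace G] [IsTopologicalGroup G] [CompactSpace G] [T2Space G]
    [CStarAlgebra A] [CStarAlgebra Ahat]
    -- the central extension `1 → Z → Ĝ → G → 1` and the free system `(A, G, α)`
    (E : CentralExtension Z Ghat G)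
    (α : CStarDynamicalSystem G A) (_hα : α.IsFree)
    -- the free system `(Â, Z, θ)` over `A`
    (θ : CStarDynamicalSystem Z Ahat) (hθ : θ.IsFree)
    (j : A →⋆ₐ[ℂ] Ahat) (hj : IsFixedPointEmbedding θ j)
    -- `α(G) ⊆ Aut(A)_[Â]`
    (_hlift : ∀ g, α.act g ∈ liftableAut θ j)
    (αhat : Ghat → (Ahat ≃⋆ₐ[ℂ] Ahat)) (hαhat : LiftingConditions E α θ j αhat)
    -- `[δ_{α̂,G}]` is trivial in `H²_S(G, Gau_Z(Â))`
    (hclass : hαhat.obstructionClass hj hθ = 1) :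
    ∃ β : Ghat →* (Ahat ≃⋆ₐ[ℂ] Ahat),
      (∀ g a, β g (j a) = j (α.act (E.q g) a)) ∧ ∀ z, β (E.ι z) = θ.act z := by
  obtain ⟨f, hf⟩ := hαhat.exists_defect_eq_of_obstructionClass_eq_one hj hθ hclass
  refine ⟨MonoidHom.mk' (fun g => (f (E.q g)).1⁻¹ * αhat g) (hαhat.corrected_mul hθ hf),
    fun g a => ?_, fun z => ?_⟩
  -- The correction acts after `αhat g`, whose value on `j a` lies in the fixed point algebra, where
  -- gauge transformations are the identity.
  · have hmem : j (α.act (E.q g) a) ∈ θ.fixedPointAlgebra := hj.range_eq ▸ ⟨_, rfl⟩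
    change (f (E.q g)).1⁻¹ (αhat g (j a)) = _
    rw [hαhat.lift]
    exact (inv_mem (f (E.q g)).2).2 _ hmem
  · have hq : E.q (E.ι z) = 1 := MonoidHom.mem_ker.mp (E.exact ▸ ⟨z, rfl⟩)
    -- At `(1, 1)` the defect is the identity and the coboundary collapses to `f 1`, so `f` is
    -- automatically normalised.
    have h1 : (f 1).1 = 1 := by
      have e := hf 1 1
      simp only [map_one, mul_one, hαhat.map_one, inv_one, one_mul, mul_inv_cancel_right] at e
      exact e.symm
    change (f (E.q (E.ι z))).1⁻¹ * αhat (E.ι z) = _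
    rw [hq, h1, inv_one, one_mul, hαhat.restrict]
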